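/- Let $n$ be a positive integer and let $\mathcal{C}$ be an additive and idempotent complete category (not assumed to be skeletally small). An $n$-kernel of a morphism $f : X \to Y$ is a sequence $X_n \to \cdots \to X_1 \to X$ in $\mathcal{C}$ such that $0 \to \mathcal{C}(-,X_n) \to \cdots \to \mathcal{C}(-,X_1) \to \mathcal{C}(-,X) \to \mathcal{C}(-,Y)$, with last arrow $\mathcal{C}(-,f)$, is exact at every object; $n$-cokernels are defined dually. Suppose that $\mathcal{C}$ is $n$-abelian, that is: every morphism has an $n$-kernel and an $n$-cokernel; for every monomorphism $f : X \to Y$ and every $n$-cokernel $Y \xrightarrow{g_1} Y_1 \to \cdots \xrightarrow{g_n} Y_n$ of $f$, the sequence $X \xrightarrow{f} Y \xrightarrow{g_1} \cdots \xrightarrow{g_{n-1}} Y_{n-1}$ is an $n$-kernel of $g_n$; and dually, for every epimorphism $f : X \to Y$ and every $n$-kernel $X_n \xrightarrow{f_n} \cdots \xrightarrow{f_1} X$ of $f$, the sequence $X_{n-1} \xrightarrow{f_{n-1}} \cdots \xrightarrow{f_1} X \xrightarrow{f} Y$ is an $n$-cokernel of $f_n$. Suppose also that $\mathcal{C}$ is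 not von Neumann regular, that is, not every morphism of $\mathcal{C}$ is a split epimorphism followed by a split monomorphism. Let $\operatorname{mod}\mathcal{C}$ be the category of finitely presented $\mathcal{C}$-modules, that is, of additive functors $F : \mathcal{C}^{\mathrm{op}} \to \mathrm{Ab}$ that admit an exact sequence $\mathcal{C}(-,X) \xrightarrow{\mathcal{C}(-,f)} \mathcal{C}(-,Y) \to F \to 0$ for some morphism $f : X \to Y$ of $\mathcal{C}$, and let $\operatorname{pd} F$ be the projective dimension of $F$ in $\operatorname{mod}\mathcal{C}$. Let $F^{*}$ be the functor $X \mapsto \operatorname{Hom}(F,\mathcal{C}(-,X))$, let $F^{**}$ be the functor $X \mapsto \operatorname{Hom}(F^{*},\mathcal{C}(X,-))$, and call $F$ reflexive if the canonical (evaluation) morphism $F \to F^{**}$ is an isomorphism. Then the following are equivalent: (a) $n \geq 2$. (b) Every $F \in \operatorname{mod}\mathcal{C}$ with $\operatorname{pd} F = 1$ is reflexive. (c) There is some $F \in \operatorname{mod}\mathcal{C}$ with $\operatorname{pd} F = 1$ that is reflexive. (d) There is some $F \in \operatorname{mod}\mathcal{C}$ with $\operatorname{pd} F \geq 1$ that is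 reflexive. -/

import Mathlib

open CategoryTheory CategoryTheory.Limits Opposite

universe w v u

noncomputable section

namespace NAbelian

/-! ### Exactness of sequences of functors with values in abelian groups -/

section Exactness

variable {J : Type u} [Category.{v} J] {F G H : J ⥤ AddCommGrpCat.{w}}

/-- `F ⟶ G ⟶ H` is exact: every component is an exact sequence of abelian groups. -/
def ModExact (α : F ⟶ G) (β : G ⟶ H) : Prop :=
  ∀ X : J, Function.Exact (α.app X) (β.app X)

/-- `0 ⟶ F ⟶ G` is exact. -/
def ModMono (α : F ⟶ G) : Prop := ∀ X : J, Function.Injective (α.app X)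

/-- `F ⟶ G ⟶ 0` is exact. -/
def ModEpi (α : F ⟶ G) : Prop := ∀ X : J, Function.Surjective (α.app X)

end Exactness

variable {C : Type u} [Category.{v} C] [Preadditive C]

/-! ### `n`-kernels, `n`-cokernels and `n`-abelian categories

A sequence `X_n ⟶ ⋯ ⟶ X_1 ⟶ X`, followed by `f : X ⟶ Y`, is recorded as one sequence of
`n + 1` composable arrows whose last arrow is `f`. Dually, `f : X ⟶ Y` followed by
`Y ⟶ Y_1 ⟶ ⋯ ⟶ Y_n` is recorded as one sequence of `n + 1` composable arrows whose first
arrow is `f`. -/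

/-- The arrow `S_i ⟶ S_{i+1}` of a sequence `S_0 ⟶ S_1 ⟶ ⋯ ⟶ S_{n+1}`. -/
abbrev arr {n : ℕ} (S : ComposableArrows C (n + 1)) (i : ℕ) (hi : i ≤ n) :
    S.obj' i ⟶ S.obj' (i + 1) :=
  S.map' i (i + 1)

/-- The last arrow of `S_0 ⟶ ⋯ ⟶ S_n ⟶ S_{n+1}` is `f`, and `S_0 ⟶ ⋯ ⟶ S_n` is an `n`-kernel
of `f`: the sequence `0 ⟶ C(-, S_0) ⟶ ⋯ ⟶ C(-, S_n) ⟶ C(-, S_{n+1})` is exact. -/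
structure IsNKernel {n : ℕ} (S : ComposableArrows C (n + 1)) {X Y : C} (f : X ⟶ Y) : Prop where
  last_eq : Arrow.mk (arr S n le_rfl) = Arrow.mk f
  mono : ModMono (preadditiveYoneda.map (arr S 0 (Nat.zero_le n)))
  exact : ∀ (i : ℕ) (hi : i + 1 ≤ n),
    ModExact (preadditiveYoneda.map (arr S i (by omega)))
      (preadditiveYoneda.map (arr S (i + 1) hi))

/-- The first arrow of `S_0 ⟶ S_1 ⟶ ⋯ ⟶ S_{n+1}` is `f`, and `S_1 ⟶ ⋯ ⟶ S_{n+1}` is an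
`n`-cokernel of `f`: the sequence `0 ⟶ C(S_{n+1}, -) ⟶ ⋯ ⟶ C(S_1, -) ⟶ C(S_0, -)` is exact. -/
structure IsNCokernel {n : ℕ} (S : ComposableArrows C (n + 1)) {X Y : C} (f : X ⟶ Y) : Prop where
  first_eq : Arrow.mk (arr S 0 (Nat.zero_le n)) = Arrow.mk f
  mono : ModMono (preadditiveCoyoneda.map (arr S n le_rfl).op)
  exact : ∀ (i : ℕ) (hi : i + 1 ≤ n),
    ModExact (preadditiveCoyoneda.map (arr S (i + 1) hi).op)
      (preadditiveCoyoneda.map (arr S i (by omega)).op)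

variable (C) in
/-- The axioms of an `n`-abelian category, for an additive and idempotent complete category `C`
and a positive integer `n`. -/
structure IsNAbelian [HasFiniteBiproducts C] [IsIdempotentComplete C] (n : ℕ) : Prop where
  /-- Every morphism has an `n`-kernel. -/
  hasNKernels : ∀ {X Y : C} (f : X ⟶ Y), ∃ S : ComposableArrows C (n + 1), IsNKernel S f
  /-- Every morphism has an `n`-cokernel. -/
  hasNCokernels : ∀ {X Y : C} (f : X ⟶ Y), ∃ S : ComposableArrows C (n + 1), IsNCokernel S f
  /-- Every monomorphism, followed by any `n`-cokernel of it without the last arrow, is an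
  `n`-kernel of that last arrow. -/
  mono_isNKernel : ∀ {X Y : C} (f : X ⟶ Y), Mono f → ∀ S : ComposableArrows C (n + 1),
    IsNCokernel S f → IsNKernel S (arr S n le_rfl)
  /-- Every epimorphism, preceded by any `n`-kernel of it without the first arrow, is an
  `n`-cokernel of that first arrow. -/
  epi_isNCokernel : ∀ {X Y : C} (f : X ⟶ Y), Epi f → ∀ S : ComposableArrows C (n + 1),
    IsNKernel S f → IsNCokernel S (arr S 0 (Nat.zero_le n))

variable (C) in
/-- Every morphism is a split epimorphism followed by a split monomorphism. -/
def IsVonNeumannRegular : Prop :=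
  ∀ {X Y : C} (f : X ⟶ Y), ∃ (Z : C) (p : X ⟶ Z) (j : Z ⟶ Y),
    IsSplitEpi p ∧ IsSplitMono j ∧ p ≫ j = f

/-! ### Finitely presented modules -/

variable (C) in
/-- A contravariant functor `F` from `C` to abelian groups is a finitely presented `C`-module:
it is additive and there is an exact sequence `C(-, X) ⟶ C(-, Y) ⟶ F ⟶ 0` whose first arrow is
induced by some `f : X ⟶ Y`. -/
def isFinitelyPresented : ObjectProperty (Cᵒᵖ ⥤ AddCommGrpCat.{v}) := fun F =>
  F.Additive ∧ ∃ (X Y : C) (f : X ⟶ Y) (π : preadditiveYoneda.obj Y ⟶ F),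
    ModExact (preadditiveYoneda.map f) π ∧ ModEpi π

variable (C) in
/-- The category `mod C` of finitely presented (right) `C`-modules. -/
abbrev FPMod := (isFinitelyPresented C).FullSubcategory

/-! ### Projective dimension -/

/-- `F` has a projective resolution `0 ⟶ P_d ⟶ ⋯ ⟶ P_0 ⟶ F ⟶ 0` in `mod C` (continued by
zeros to the left). -/
def HasProjectiveResolutionOfLength (F : FPMod C) (d : ℕ) : Prop :=
  ∃ (P : ℕ → FPMod C) (δ : ∀ i, P (i + 1) ⟶ P i) (ε : P 0 ⟶ F),
    (∀ i, Projective (P i)) ∧ (∀ i, d < i → IsZero (P i)) ∧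
      ModEpi ε.hom ∧ ModExact (δ 0).hom ε.hom ∧ ∀ i, ModExact (δ (i + 1)).hom (δ i).hom

/-- The projective dimension of `F` in `mod C`: the least length of a projective resolution,
`⊤` if there is none of finite length. -/
def projDim (F : FPMod C) : ℕ∞ :=
  ⨅ (d : ℕ) (_ : HasProjectiveResolutionOfLength F d), (d : ℕ∞)

/-! ### Duals and reflexive modules -/

/-- The dual `F^*` of a right module `F`: the left module `X ↦ Hom(F, C(-, X))`. If `C` is
large, these groups live in a larger universe than the Hom groups of `C`. -/
def dual (F : Cᵒᵖ ⥤ AddCommGrpCat.{v}) : C ⥤ AddCommGrpCat.{max u v} :=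
  preadditiveYoneda ⋙ preadditiveCoyoneda.obj (op F)

/-- The dual `G^*` of a left module `G`: the right module `X ↦ Hom(G, C(X, -))`. -/
def dualLeft (G : C ⥤ AddCommGrpCat.{max u v}) : Cᵒᵖ ⥤ AddCommGrpCat.{max u v} :=
  preadditiveCoyoneda ⋙
    (Functor.whiskeringRight C _ _).obj AddCommGrpCat.uliftFunctor.{u, v} ⋙
      preadditiveCoyoneda.obj (op G)

/-- Evaluation at `x ∈ F(X)`: the natural transformation `F^* ⟶ C(X, -)` that sends
`φ : F ⟶ C(-, Y)` to `φ_X(x) ∈ C(X, Y)`. -/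
def evalAt (F : Cᵒᵖ ⥤ AddCommGrpCat.{v}) (X : Cᵒᵖ) (x : F.obj X) :
    dual F ⟶ preadditiveCoyoneda.obj X ⋙ AddCommGrpCat.uliftFunctor.{u, v} where
  app Y := AddCommGrpCat.ofHom
    { toFun := fun (φ : F ⟶ preadditiveYoneda.obj Y) => ULift.up (φ.app X x)
      map_zero' := rfl
      map_add' := fun _ _ => rfl }
  naturality _ _ _ := rfl

/-- The canonical morphism `F ⟶ F^{**}`, which sends `x` to the evaluation at `x`. -/
def toDoubleDual (F : Cᵒᵖ ⥤ AddCommGrpCat.{v}) :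
    F ⋙ AddCommGrpCat.uliftFunctor.{u, v} ⟶ dualLeft (dual F) where
  app X := AddCommGrpCat.ofHom
    { toFun := fun x => evalAt F X x.down
      map_zero' := by
        apply NatTrans.ext
        funext Y
        ext φ
        exact congrArg ULift.up (map_zero (ConcreteCategory.hom (NatTrans.app φ X)))
      map_add' := fun x y => by
        apply NatTrans.ext
        funext Y
        ext φ
        exact congrArg ULift.up (map_add (ConcreteCategory.hom (NatTrans.app φ X)) x.down y.down) }
  naturality X X' f := by
    ext x
    apply NatTrans.ext
    funext Y
    ext φ
    exact congrArg ULift.up (NatTrans.naturality_apply (φ : F ⟶ preadditiveYoneda.obj Y) f x.down)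

/-- `F` is reflexive: the canonical morphism `F ⟶ F^{**}` is an isomorphism. -/
def IsReflexive (F : FPMod C) : Prop := IsIso (toDoubleDual F.obj)

end NAbelian

end

/-! Idempotent completeness makes the projectives of `mod C` exactly the representables, up to
isomorphism. So pd F ≤ 1 means that F is presented by a monomorphism f : X ⟶ Y
(`exists_mono_presents`).

Let g : Y ⟶ Y₁ begin an n-cokernel of a presenting map f. As g is a weak cokernel, every map from F
to a representable factors through the map φ : F ⟶ C(-, Y₁) induced by g, so an element of F** is
determined by its value at φ. Exactness at C(-, Y) then makes F ⟶ F** injective, and exactness at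
C(-, Y₁) makes it surjective (`Presents.isReflexive`). If f is mono and n ≥ 2, the n-abelian axiom
supplies both.

If n = 1, then g is epi, hence a true cokernel, and φ is universal: F** is C(-, Y₁), and a reflexive
F is representable (`Presents.exists_iso_yoneda_of_isReflexive`), so pd F = 0.

Non-regularity gives a module with pd F = 1. If all monomorphisms split, split factorizations
propagate along an n-kernel up to any given morphism (`exists_mono_not_isSplitMono`); and a
non-split monomorphism presents a non-projective module. -/

noncomputable section

namespace NAbelian

/-! ### Exactness in functor categories -/

section FunctorCategory

variable {J : Type u} [Category.{v} J] {F G H : J ⥤ AddCommGrpCat.{w}}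

lemma ModExact.comp_eq_zero {α : F ⟶ G} {β : G ⟶ H} (h : ModExact α β) : α ≫ β = 0 := by
  ext X x
  exact (h X).apply_apply_eq_zero x

/-- A morphism that vanishes on the image of `α` descends along the cokernel `β` of `α`. -/
lemma ModExact.exists_desc {α : F ⟶ G} {β : G ⟶ H} (h : ModExact α β) (hβ : ModEpi β)
    {K : J ⥤ AddCommGrpCat.{w}} (t : G ⟶ K) (ht : α ≫ t = 0) : ∃ s : H ⟶ K, β ≫ s = t := by
  have key : ∀ (X : J) (x y : G.obj X), β.app X x = β.app X y → t.app X x = t.app X y := by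
    intro X x y hxy
    obtain ⟨z, hz⟩ := (h X (x - y)).1 (by rw [map_sub, hxy, sub_self])
    have h0 : t.app X (α.app X z) = 0 := by
      have := ConcreteCategory.congr_hom (NatTrans.congr_app ht X) z
      simpa using this
    rw [hz, map_sub, sub_eq_zero] at h0
    exact h0
  have hs : ∀ (X : J) (x : H.obj X), β.app X (Function.surjInv (hβ X) x) = x :=
    fun X x => Function.surjInv_eq (hβ X) x
  -- The descent applies `t` to a chosen preimage; independence of the choice (`key`) yields
  -- additivity and naturality.
  refine ⟨{ app := fun X => AddCommGrpCat.ofHom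
              (AddMonoidHom.mk' (fun x => t.app X (Function.surjInv (hβ X) x)) ?_)
            naturality := ?_ }, ?_⟩
  · intro x y
    rw [← map_add]
    exact key X _ _ (by rw [hs, map_add, hs, hs])
  · intro X Y a
    ext x
    refine (key Y _ (G.map a (Function.surjInv (hβ X) x)) ?_).trans
      (NatTrans.naturality_apply t a _)
    refine (hs Y _).trans ((congrArg (H.map a) (hs X x).symm).trans ?_)
    exact (NatTrans.naturality_apply β a _).symm
  · ext X x
    exact key X _ _ (hs X _)

lemma ModEpi.epi {α : F ⟶ G} (h : ModEpi α) : Epi α := by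
  rw [NatTrans.epi_iff_epi_app]
  exact fun X => (AddCommGrpCat.epi_iff_surjective _).2 (h X)

lemma isIso_iff_app_bijective (α : F ⟶ G) :
    IsIso α ↔ ∀ X, Function.Bijective (α.app X) := by
  rw [NatTrans.isIso_iff_isIso_app]
  exact forall_congr' fun X => ConcreteCategory.isIso_iff_bijective _

lemma modExact_cokernel (α : F ⟶ G) : ModExact α (cokernel.π α) := fun X =>
  (ShortComplex.ab_exact_iff_function_exact _).1
    ((ShortComplex.exact_cokernel α).map ((evaluation J AddCommGrpCat.{w}).obj X))

lemma modEpi_cokernel (α : F ⟶ G) : ModEpi (cokernel.π α) := fun X =>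
  (AddCommGrpCat.epi_iff_surjective _).1 ((NatTrans.epi_iff_epi_app _).1 inferInstance X)

/-- A quotient of an additive functor is additive. -/
lemma ModEpi.additive [Preadditive J] [F.Additive] {α : F ⟶ G} (h : ModEpi α) : G.Additive where
  map_add {X Y a b} := by
    ext x
    obtain ⟨x, rfl⟩ := h X x
    have e : ∀ c : X ⟶ Y, G.map c (α.app X x) = α.app Y (F.map c x) :=
      fun c => (NatTrans.naturality_apply α c x).symm
    rw [e, F.map_add]
    refine (map_add (α.app Y).hom (F.map a x) (F.map b x)).trans ?_
    exact congrArg₂ (· + ·) (e a).symm (e b).symm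

end FunctorCategory

variable {C : Type u} [Category.{v} C] [Preadditive C]

/-! ### Yoneda for additive functors -/

section Representable

/-- The morphism `C(-, Y) ⟶ F` that corresponds to `x ∈ F(Y)`. -/
def ofElement (F : Cᵒᵖ ⥤ AddCommGrpCat.{v}) [F.Additive] {Y : C} (x : F.obj (op Y)) :
    preadditiveYoneda.obj Y ⟶ F where
  app W := AddCommGrpCat.ofHom (AddMonoidHom.mk' (fun w : W.unop ⟶ Y => F.map w.op x)
    (fun a b => ConcreteCategory.congr_hom (F.map_add (f := Quiver.Hom.op a) (g := b.op)) x))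
  naturality W W' a := by
    ext w
    exact ConcreteCategory.congr_hom (F.map_comp (Quiver.Hom.op w) a) x

lemma ofElement_apply (F : Cᵒᵖ ⥤ AddCommGrpCat.{v}) [F.Additive] {Y W : C} (x : F.obj (op Y))
    (w : W ⟶ Y) : (ofElement F x).app (op W) w = F.map w.op x := rfl

lemma app_eq_map {F : Cᵒᵖ ⥤ AddCommGrpCat.{v}} {Y W : C} (π : preadditiveYoneda.obj Y ⟶ F)
    (w : W ⟶ Y) : π.app (op W) w = F.map w.op (π.app (op Y) (𝟙 Y)) :=
  (congrArg (π.app (op W)) (Category.comp_id w).symm).trans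
    (NatTrans.naturality_apply π w.op (𝟙 Y))

lemma yoneda_hom_ext {F : Cᵒᵖ ⥤ AddCommGrpCat.{v}} {Y : C} {π ρ : preadditiveYoneda.obj Y ⟶ F}
    (h : π.app (op Y) (𝟙 Y) = ρ.app (op Y) (𝟙 Y)) : π = ρ := by
  ext W w
  exact (app_eq_map π w).trans ((congrArg _ h).trans (app_eq_map ρ w).symm)

end Representable

/-! ### Epimorphisms and projectives in `mod C` -/

section FPMod

open ZeroObject

/-- The morphism `f` presents `F`: the sequence `C(-, X) ⟶ C(-, Y) ⟶ F ⟶ 0` is exact. -/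
def Presents {X Y : C} (f : X ⟶ Y) (F : Cᵒᵖ ⥤ AddCommGrpCat.{v}) : Prop :=
  ∃ π : preadditiveYoneda.obj Y ⟶ F, ModExact (preadditiveYoneda.map f) π ∧ ModEpi π

lemma Presents.isFinitelyPresented {X Y : C} {f : X ⟶ Y} {F : Cᵒᵖ ⥤ AddCommGrpCat.{v}}
    (h : Presents f F) : isFinitelyPresented C F := by
  obtain ⟨π, h1, h2⟩ := h
  exact ⟨h2.additive, X, Y, f, π, h1, h2⟩

lemma presents_cokernel {X Y : C} (f : X ⟶ Y) :
    Presents f (cokernel (preadditiveYoneda.map f)) :=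
  ⟨_, modExact_cokernel _, modEpi_cokernel _⟩

lemma presents_yoneda [HasZeroObject C] (Y : C) :
    Presents (0 : (0 : C) ⟶ Y) (preadditiveYoneda.obj Y) := by
  refine ⟨𝟙 _, fun W (w : W.unop ⟶ Y) => ⟨fun (h : w = 0) => ⟨0, ?_⟩, ?_⟩, fun W w => ⟨w, rfl⟩⟩
  · rw [map_zero]
    exact h.symm
  · rintro ⟨a, rfl⟩
    exact comp_zero (f := (a : W.unop ⟶ _))

/-- The representable functor `C(-, Y)` as a finitely presented module. -/
def yonedaFP [HasZeroObject C] (Y : C) : FPMod C :=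
  ⟨preadditiveYoneda.obj Y, (presents_yoneda Y).isFinitelyPresented⟩

lemma epi_of_modEpi {F G : FPMod C} {e : F ⟶ G} (h : ModEpi e.hom) : Epi e where
  left_cancellation a b hab := by
    have := h.epi
    ext1
    exact (cancel_epi e.hom).1 (congrArg (·.hom) hab)

/-- Epimorphisms of finitely presented modules are surjective, because cokernels of morphisms of
finitely presented modules are finitely presented. -/
lemma modEpi_of_epi [HasFiniteBiproducts C] {F G : FPMod C} (e : F ⟶ G) [Epi e] :
    ModEpi e.hom := by
  have := hasBinaryBiproducts_of_finite_biproducts C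
  obtain ⟨-, X', Y', f', π', h1', h2'⟩ := F.property
  obtain ⟨hG, X, Y, f, π, h1, h2⟩ := G.property
  obtain ⟨t, ht⟩ := h2 (op Y') (e.hom.app (op Y') (π'.app (op Y') (𝟙 Y')))
  change Y' ⟶ Y at t
  have het : π' ≫ e.hom = preadditiveYoneda.map t ≫ π := by
    refine yoneda_hom_ext (ht.symm.trans ?_)
    exact congrArg (π.app (op Y')) (Category.id_comp t).symm
  have hq := modExact_cokernel e.hom
  -- The relations of the cokernel are those of `G` together with `t`, the lifted image of the
  -- generator of `F`.
  have hpres : Presents (biprod.desc f t) (cokernel e.hom) := by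
    refine ⟨π ≫ cokernel.π e.hom, fun W (w : W.unop ⟶ Y) => ⟨fun h => ?_, ?_⟩, fun W x => ?_⟩
    · obtain ⟨z, hz⟩ := (hq W _).1 h
      obtain ⟨y, rfl⟩ := h2' W z
      change W.unop ⟶ Y' at y
      have hy : π.app W (y ≫ t) = π.app W w :=
        (ConcreteCategory.congr_hom (NatTrans.congr_app het W) y).symm.trans hz
      have h0 : π.app W (w - y ≫ t) = 0 := by
        refine (map_sub (π.app W).hom w (y ≫ t)).trans ?_
        exact sub_eq_zero.2 hy.symm
      obtain ⟨x, hx⟩ := (h1 W _).1 h0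
      change W.unop ⟶ X at x
      replace hx : x ≫ f = w - y ≫ t := hx
      refine ⟨(biprod.lift x y : W.unop ⟶ X ⊞ Y'), ?_⟩
      change biprod.lift x y ≫ biprod.desc f t = w
      rw [biprod.lift_desc, hx, sub_add_cancel]
    · rintro ⟨x, rfl⟩
      change W.unop ⟶ X ⊞ Y' at x
      obtain ⟨a, b, hab⟩ : ∃ (a : W.unop ⟶ X) (b : W.unop ⟶ Y'),
          x ≫ biprod.desc f t = a ≫ f + b ≫ t :=
        ⟨x ≫ biprod.fst, x ≫ biprod.snd, by simp [biprod.desc_eq]⟩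
      change (cokernel.π e.hom).app W (π.app W (x ≫ biprod.desc f t)) = 0
      rw [hab]
      have e1 : π.app W (a ≫ f + b ≫ t) = π.app W (a ≫ f) + π.app W (b ≫ t) :=
        map_add (π.app W).hom _ _
      have e2 : π.app W (a ≫ f) = 0 := (h1 W).apply_apply_eq_zero a
      have e3 : π.app W (b ≫ t) = e.hom.app W (π'.app W b) :=
        (ConcreteCategory.congr_hom (NatTrans.congr_app het W) b).symm
      rw [e1, e2, e3, zero_add]
      exact (hq W).apply_apply_eq_zero _
    · obtain ⟨y, rfl⟩ := modEpi_cokernel e.hom W x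
      obtain ⟨z, rfl⟩ := h2 W y
      exact ⟨z, rfl⟩
  let Q : FPMod C := ⟨cokernel e.hom, hpres.isFinitelyPresented⟩
  have hzero : (ObjectProperty.homMk (cokernel.π e.hom) : G ⟶ Q) = ObjectProperty.homMk 0 := by
    rw [← cancel_epi e]
    ext1
    simp [cokernel.condition]
  have hπ : cokernel.π e.hom = 0 := congrArg (·.hom) hzero
  intro W y
  exact (hq W y).1 (by rw [hπ]; rfl)

/-- By Yoneda, a lift amounts to a preimage of one element; it exists because epimorphisms in `mod
C` are surjective. -/
lemma projective_yonedaFP [HasFiniteBiproducts C] (Y : C) : Projective (yonedaFP Y) where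
  factors {E B} b e he := by
    have hE := E.property.1
    obtain ⟨x, hx⟩ := modEpi_of_epi e (op Y) (b.hom.app (op Y) (𝟙 Y))
    refine ⟨ObjectProperty.homMk (ofElement E.obj x), ?_⟩
    ext1
    refine yoneda_hom_ext (Eq.trans ?_ hx)
    change e.hom.app (op Y) ((ofElement E.obj x).app (op Y) (𝟙 Y)) = _
    rw [ofElement_apply]
    simp

lemma exists_section [HasZeroObject C] {F : FPMod C} [Projective F] {Y : C}
    {π : preadditiveYoneda.obj Y ⟶ F.obj} (h : ModEpi π) :
    ∃ s : F.obj ⟶ preadditiveYoneda.obj Y, s ≫ π = 𝟙 F.obj := by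
  let p : yonedaFP Y ⟶ F := ObjectProperty.homMk π
  have : Epi p := epi_of_modEpi h
  exact ⟨(Projective.factorThru (𝟙 F) p).hom,
    congrArg (·.hom) (Projective.factorThru_comp (𝟙 F) p)⟩

/-- A module presented by `f` is projective only if `f` has a quasi-inverse. -/
lemma Presents.exists_quasiInverse [HasFiniteBiproducts C] {F : FPMod C} {X Y : C} {f : X ⟶ Y}
    (h : Presents f F.obj) [Projective F] : ∃ r : Y ⟶ X, f ≫ r ≫ f = f := by
  obtain ⟨π, h1, h2⟩ := h
  obtain ⟨s, hs⟩ := exists_section h2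
  obtain ⟨e, he⟩ := preadditiveYoneda.map_surjective (π ≫ s)
  have hfe : f ≫ e = 0 := by
    apply preadditiveYoneda.map_injective
    rw [Functor.map_comp, he, ← Category.assoc, h1.comp_eq_zero, zero_comp]
    ext
    exact comp_zero.symm
  have heπ : preadditiveYoneda.map e ≫ π = π := by rw [he, Category.assoc, hs, Category.comp_id]
  -- Since `π` kills 1 - e, this map factors as r ≫ f; with f ≫ e = 0 it follows that f ≫ r ≫ f = f.
  have h0 : π.app (op Y) (𝟙 Y - e) = 0 := by
    refine (map_sub (π.app (op Y)).hom (𝟙 Y) e).trans (sub_eq_zero.2 ?_)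
    have := ConcreteCategory.congr_hom (NatTrans.congr_app heπ (op Y)) (𝟙 Y)
    refine this.symm.trans ?_
    exact congrArg (π.app (op Y)) (Category.id_comp e)
  obtain ⟨r, hr⟩ := (h1 (op Y) _).1 h0
  change Y ⟶ X at r
  replace hr : r ≫ f = 𝟙 Y - e := hr
  exact ⟨r, by rw [hr, Preadditive.comp_sub, hfe, Category.comp_id, sub_zero]⟩

/-- Projective finitely presented modules are representable. -/
lemma exists_iso_yoneda [HasFiniteBiproducts C] [IsIdempotentComplete C] (P : FPMod C)
    [Projective P] : ∃ Z : C, Nonempty (preadditiveYoneda.obj Z ≅ P.obj) := by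
  obtain ⟨-, X, Y, f, π, h1, h2⟩ := P.property
  obtain ⟨s, hs⟩ := exists_section h2
  obtain ⟨e, he⟩ := preadditiveYoneda.map_surjective (π ≫ s)
  have hee : e ≫ e = e := by
    apply preadditiveYoneda.map_injective
    rw [Functor.map_comp, he, Category.assoc, reassoc_of% hs]
  obtain ⟨Z, i, q, hiq, hqi⟩ := IsIdempotentComplete.idempotents_split Y e hee
  refine ⟨Z, ⟨preadditiveYoneda.map i ≫ π, s ≫ preadditiveYoneda.map q, ?_, ?_⟩⟩
  · rw [Category.assoc, ← Category.assoc π, ← he, ← Functor.map_comp, ← Functor.map_comp, ← hqi,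
      Category.assoc, hiq, Category.comp_id, hiq, CategoryTheory.Functor.map_id]
  · rw [Category.assoc, ← Category.assoc _ _ π, ← Functor.map_comp, hqi, he, Category.assoc, hs,
      Category.comp_id, hs]

lemma apply_eq_zero_of_isZero {P : FPMod C} (hP : IsZero P) {W : Cᵒᵖ} (x : P.obj.obj W) : x = 0 := by
  have h : 𝟙 P = ObjectProperty.homMk 0 := hP.eq_of_src _ _
  exact ConcreteCategory.congr_hom (NatTrans.congr_app (congrArg (·.hom) h) W) x

lemma isZero_yonedaFP_zero [HasZeroObject C] : IsZero (yonedaFP (0 : C)) where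
  unique_to F := ⟨⟨⟨ObjectProperty.homMk 0⟩, fun a => by
    ext1
    refine yoneda_hom_ext ?_
    have : (𝟙 (0 : C)) = 0 := (isZero_zero C).eq_of_src _ _
    rw [this]
    exact (map_zero (a.hom.app _).hom).trans (map_zero _).symm⟩⟩
  unique_from F := ⟨⟨⟨ObjectProperty.homMk 0⟩, fun a => by
    ext W x
    exact (isZero_zero C).eq_of_tgt (Y := W.unop) _ _⟩⟩

end FPMod

/-! ### Resolutions of length at most one -/

section ProjectiveDimension

lemma hasProjectiveResolutionOfLength_one_of_projDim_eq_one {F : FPMod C} (h : projDim F = 1) :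
    HasProjectiveResolutionOfLength F 1 := by
  -- A strict bound on the infimum produces an actual length d ≤ 1, and a resolution of length 0
  -- also counts as one of length 1.
  have h2 : projDim F < 2 := by rw [h]; exact_mod_cast Nat.one_lt_two
  obtain ⟨d, hd⟩ := iInf_lt_iff.1 h2
  obtain ⟨⟨P, δ, ε, hP, hz, hrest⟩, hd⟩ := iInf_lt_iff.1 hd
  have hd' : d < 2 := by exact_mod_cast hd
  exact ⟨P, δ, ε, hP, fun i hi => hz i (by omega), hrest⟩

lemma not_hasProjectiveResolutionOfLength_zero {F : FPMod C} (h : 1 ≤ projDim F) :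
    ¬ HasProjectiveResolutionOfLength F 0 := by
  intro h0
  have h1 : projDim F ≤ ((0 : ℕ) : ℕ∞) := iInf₂_le 0 h0
  exact absurd (h.trans h1) (by decide)

lemma projDim_eq_one {F : FPMod C} (h1 : HasProjectiveResolutionOfLength F 1)
    (h0 : ¬ HasProjectiveResolutionOfLength F 0) : projDim F = 1 := by
  refine le_antisymm (iInf₂_le 1 h1) (le_iInf₂ fun d hd => ?_)
  have : d ≠ 0 := by rintro rfl; exact h0 hd
  exact_mod_cast Nat.one_le_iff_ne_zero.2 this

/-- Here `P 1` vanishes, so the augmentation is also injective. -/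
lemma HasProjectiveResolutionOfLength.projective {F : FPMod C}
    (h : HasProjectiveResolutionOfLength F 0) : Projective F := by
  obtain ⟨P, δ, ε, hP, hz, hε, h0, -⟩ := h
  have hiso : IsIso ε.hom := by
    refine (isIso_iff_app_bijective _).2 fun W => ⟨?_, hε W⟩
    refine (injective_iff_map_eq_zero (ε.hom.app W).hom).2 fun x hx => ?_
    obtain ⟨y, rfl⟩ := (h0 W x).1 hx
    rw [apply_eq_zero_of_isZero (hz 1 one_pos) y]
    exact map_zero ((δ 0).hom.app W).hom
  have : IsIso ε := (ObjectProperty.isIso_hom_iff ε).1 hiso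
  exact Projective.of_iso (asIso ε) (hP 0)

/-- The sequence of modules `A, B, Z, Z, …`. -/
def twoTermObj (A B Z : FPMod C) : ℕ → FPMod C
  | 0 => A
  | 1 => B
  | _ + 2 => Z

/-- The complex `⋯ ⟶ Z ⟶ Z ⟶ B ⟶ A` whose only possibly nonzero arrow is `d`. -/
def twoTermMap {A B : FPMod C} (Z : FPMod C) (d : B ⟶ A) :
    ∀ i, twoTermObj A B Z (i + 1) ⟶ twoTermObj A B Z i
  | 0 => d
  | _ + 1 => ObjectProperty.homMk 0

open ZeroObject

/-- The parameter `k` treats lengths 0 and 1 together: only for `k = 0` must the term `B` in degree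
1 vanish. -/
lemma hasProjectiveResolutionOfLength_of_shortExact [HasFiniteBiproducts C] {A B F : FPMod C}
    (hA : Projective A) (hB : Projective B) (d : B ⟶ A) (ε : A ⟶ F) (hd : ModMono d.hom)
    (hdε : ModExact d.hom ε.hom) (hε : ModEpi ε.hom) (k : ℕ) (hk : k = 0 → IsZero B) :
    HasProjectiveResolutionOfLength F k := by
  have hZ := isZero_yonedaFP_zero (C := C)
  refine ⟨twoTermObj A B (yonedaFP 0), twoTermMap _ d, ε, ?_, ?_, hε, hdε, ?_⟩
  · rintro (_ | _ | i)
    exacts [hA, hB, projective_yonedaFP 0]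
  · rintro (_ | _ | i) hi
    · exact absurd hi (Nat.not_lt_zero _)
    · exact hk (Nat.lt_one_iff.1 hi)
    · exact hZ
  · rintro (_ | i) W x
    · refine ⟨fun hx => ⟨0, ?_⟩, ?_⟩
      · exact (map_zero _).trans (hd W (hx.trans (map_zero (d.hom.app W).hom).symm)).symm
      · rintro ⟨y, rfl⟩
        exact map_zero (d.hom.app W).hom
    · exact ⟨fun _ => ⟨0, (map_zero _).trans (apply_eq_zero_of_isZero hZ x).symm⟩, fun _ => rfl⟩

lemma hasProjectiveResolutionOfLength_zero_of_iso [HasFiniteBiproducts C] {F : FPMod C} {Y : C}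
    (e : preadditiveYoneda.obj Y ≅ F.obj) : HasProjectiveResolutionOfLength F 0 := by
  have hZ := isZero_yonedaFP_zero (C := C)
  have he := (isIso_iff_app_bijective e.hom).1 inferInstance
  refine hasProjectiveResolutionOfLength_of_shortExact (projective_yonedaFP Y)
    (projective_yonedaFP 0) (ObjectProperty.homMk 0) (ObjectProperty.homMk e.hom)
    (fun W x y _ => ?_) (fun W x => ⟨fun hx => ⟨0, ?_⟩, ?_⟩) (fun W => (he W).2) 0 (fun _ => hZ)
  · exact (apply_eq_zero_of_isZero hZ x).trans (apply_eq_zero_of_isZero hZ y).symm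
  · exact (map_zero _).trans ((he W).1 (hx.trans (map_zero (e.hom.app W).hom).symm)).symm
  · rintro ⟨y, rfl⟩
    exact map_zero (e.hom.app W).hom

lemma Presents.hasProjectiveResolutionOfLength_one [HasFiniteBiproducts C] {F : FPMod C} {X Y : C}
    {f : X ⟶ Y} [Mono f] (h : Presents f F.obj) : HasProjectiveResolutionOfLength F 1 := by
  obtain ⟨π, h1, h2⟩ := h
  exact hasProjectiveResolutionOfLength_of_shortExact (projective_yonedaFP Y)
    (projective_yonedaFP X) (ObjectProperty.homMk (preadditiveYoneda.map f))
    (ObjectProperty.homMk π) (fun W x y hxy => (cancel_mono f).1 hxy) h1 h2 1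
    (fun h => absurd h one_ne_zero)

/-- Transporting `δ 0` to representables gives `f` by Yoneda; `f` is mono because `P 2` vanishes. -/
lemma HasProjectiveResolutionOfLength.exists_mono_presents [HasFiniteBiproducts C]
    [IsIdempotentComplete C] {F : FPMod C} (h : HasProjectiveResolutionOfLength F 1) :
    ∃ (X Y : C) (f : X ⟶ Y), Mono f ∧ Presents f F.obj := by
  obtain ⟨P, δ, ε, hP, hz, hε, h0, hs⟩ := h
  have := hP 0
  have := hP 1
  obtain ⟨X, ⟨a⟩⟩ := exists_iso_yoneda (P 1)
  obtain ⟨Y, ⟨b⟩⟩ := exists_iso_yoneda (P 0)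
  have ha := (isIso_iff_app_bijective a.hom).1 inferInstance
  have hb := (isIso_iff_app_bijective b.hom).1 inferInstance
  obtain ⟨f, hf⟩ := preadditiveYoneda.map_surjective (a.hom ≫ (δ 0).hom ≫ b.inv)
  have hfb : preadditiveYoneda.map f ≫ b.hom = a.hom ≫ (δ 0).hom := by simp [hf]
  have hfb' : ∀ (W : Cᵒᵖ) (x : W.unop ⟶ X),
      b.hom.app W (x ≫ f) = (δ 0).hom.app W (a.hom.app W x) :=
    fun W x => ConcreteCategory.congr_hom (NatTrans.congr_app hfb W) x
  refine ⟨X, Y, f, Preadditive.mono_of_cancel_zero f fun {W} x hx => ?_, b.hom ≫ ε.hom,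
    fun W (y : W.unop ⟶ Y) => ⟨fun hy => ?_, ?_⟩, fun W z => ?_⟩
  · have h1 : (δ 0).hom.app (op W) (a.hom.app (op W) x) = 0 := by
      refine (hfb' (op W) x).symm.trans ?_
      rw [hx]
      exact map_zero (b.hom.app (op W)).hom
    obtain ⟨y, hy⟩ := (hs 0 (op W) _).1 h1
    rw [apply_eq_zero_of_isZero (hz 2 one_lt_two) y] at hy
    refine (ha (op W)).1 (hy.symm.trans ?_)
    exact (map_zero ((δ 1).hom.app (op W)).hom).trans (map_zero (a.hom.app (op W)).hom).symm
  · obtain ⟨z, hz⟩ := (h0 W (b.hom.app W y)).1 hy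
    obtain ⟨x, rfl⟩ := (ha W).2 z
    exact ⟨x, (hb W).1 ((hfb' W x).trans hz)⟩
  · rintro ⟨x, rfl⟩
    refine (congrArg (ε.hom.app W) (hfb' W x)).trans ?_
    exact (h0 W).apply_apply_eq_zero _
  · obtain ⟨p, rfl⟩ := hε W z
    obtain ⟨y, rfl⟩ := (hb W).2 p
    exact ⟨y, rfl⟩

end ProjectiveDimension

/-! ### Reflexivity through weak cokernels -/

section Reflexive

lemma isReflexive_iff {F : FPMod C} :
    IsReflexive F ↔ ∀ X, Function.Bijective ((toDoubleDual F.obj).app X) :=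
  isIso_iff_app_bijective _

/-- `g : Y ⟶ Z` is a weak cokernel of `f`. -/
def IsWeakCokernel {X Y Z : C} (f : X ⟶ Y) (g : Y ⟶ Z) : Prop :=
  f ≫ g = 0 ∧ ∀ {W : C} (h : Y ⟶ W), f ≫ h = 0 → ∃ t : Z ⟶ W, g ≫ t = h

/-- `f : X ⟶ Y` is a weak kernel of `g`. -/
def IsWeakKernel {X Y Z : C} (f : X ⟶ Y) (g : Y ⟶ Z) : Prop :=
  f ≫ g = 0 ∧ ∀ {W : C} (h : W ⟶ Y), h ≫ g = 0 → ∃ t : W ⟶ X, t ≫ f = h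

lemma isWeakKernel_iff {X Y Z : C} {f : X ⟶ Y} {g : Y ⟶ Z} :
    ModExact (preadditiveYoneda.map f) (preadditiveYoneda.map g) ↔ IsWeakKernel f g := by
  constructor
  · intro h
    refine ⟨?_, fun {W} k hk => (h (op W) k).1 hk⟩
    have := (h (op X)).apply_apply_eq_zero (𝟙 X)
    change (𝟙 X ≫ f) ≫ g = 0 at this
    simpa using this
  · rintro ⟨h1, h2⟩ W k
    change W.unop ⟶ Y at k
    refine ⟨fun hk => h2 k hk, ?_⟩
    rintro ⟨t, rfl⟩
    change W.unop ⟶ X at t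
    change (t ≫ f) ≫ g = 0
    rw [Category.assoc, h1, comp_zero]

lemma isWeakCokernel_of_modExact {X Y Z : C} {f : X ⟶ Y} {g : Y ⟶ Z}
    (h : ModExact (preadditiveCoyoneda.map g.op) (preadditiveCoyoneda.map f.op)) :
    IsWeakCokernel f g := by
  refine ⟨?_, fun {W} k hk => (h W k).1 hk⟩
  have := (h Z).apply_apply_eq_zero (𝟙 Z)
  change f ≫ g ≫ 𝟙 Z = 0 at this
  simpa using this

variable {F : FPMod C} {X Y Y₁ : C} {f : X ⟶ Y} {g : Y ⟶ Y₁}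

/-- If `f` presents `F` and `g` is a weak cokernel of `f`, then `g` induces a morphism
`F ⟶ C(-, Y₁)` through which all morphisms from `F` to representable functors factor. -/
lemma exists_weakly_universal {π : preadditiveYoneda.obj Y ⟶ F.obj}
    (h1 : ModExact (preadditiveYoneda.map f) π) (h2 : ModEpi π) (hg : IsWeakCokernel f g) :
    ∃ φ : F.obj ⟶ preadditiveYoneda.obj Y₁, π ≫ φ = preadditiveYoneda.map g ∧
      ∀ {Z : C} (ψ : F.obj ⟶ preadditiveYoneda.obj Z),
        ∃ t : Y₁ ⟶ Z, φ ≫ preadditiveYoneda.map t = ψ := by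
  obtain ⟨φ, hφ⟩ := h1.exists_desc h2 (preadditiveYoneda.map g) (by
    rw [← Functor.map_comp, hg.1]
    ext
    exact comp_zero)
  refine ⟨φ, hφ, fun {Z} ψ => ?_⟩
  obtain ⟨k, hk⟩ := preadditiveYoneda.map_surjective (π ≫ ψ)
  obtain ⟨t, ht⟩ := hg.2 k (by
    apply preadditiveYoneda.map_injective
    rw [Functor.map_comp, hk, ← Category.assoc, h1.comp_eq_zero, zero_comp]
    ext
    exact comp_zero.symm)
  refine ⟨t, ?_⟩
  have := h2.epi
  rw [← cancel_epi π, ← Category.assoc, hφ, ← Functor.map_comp, ht, hk]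

/-- The value of an element of the double dual at a morphism `ψ : F ⟶ C(-, Z)`. -/
def evalDual (F : FPMod C) {W : Cᵒᵖ} (α : (dualLeft (dual F.obj)).obj W) {Z : C}
    (ψ : F.obj ⟶ preadditiveYoneda.obj Z) : W.unop ⟶ Z :=
  ((NatTrans.app (F := dual F.obj)
    (G := preadditiveCoyoneda.obj W ⋙ AddCommGrpCat.uliftFunctor.{u, v}) α Z) ψ).down

lemma evalDual_comp {W : Cᵒᵖ} (α : (dualLeft (dual F.obj)).obj W) {Z Z' : C}
    (ψ : F.obj ⟶ preadditiveYoneda.obj Z) (t : Z ⟶ Z') :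
    evalDual F α (ψ ≫ preadditiveYoneda.map t) = evalDual F α ψ ≫ t :=
  congrArg ULift.down (NatTrans.naturality_apply (F := dual F.obj)
    (G := preadditiveCoyoneda.obj W ⋙ AddCommGrpCat.uliftFunctor.{u, v}) α t ψ)

lemma evalDual_ext {W : Cᵒᵖ} {α β : (dualLeft (dual F.obj)).obj W}
    (h : ∀ (Z : C) (ψ : F.obj ⟶ preadditiveYoneda.obj Z), evalDual F α ψ = evalDual F β ψ) :
    α = β := by
  apply NatTrans.ext
  funext Z
  ext ψ
  exact congrArg ULift.up (h Z ψ)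

lemma evalDual_toDoubleDual {W : Cᵒᵖ} (x : F.obj.obj W) {Z : C}
    (ψ : F.obj ⟶ preadditiveYoneda.obj Z) :
    evalDual F ((toDoubleDual F.obj).app W (ULift.up x)) ψ = ψ.app W x := rfl

lemma evalDual_zero {W : Cᵒᵖ} (α : (dualLeft (dual F.obj)).obj W) {Z : C} :
    evalDual F α (0 : F.obj ⟶ preadditiveYoneda.obj Z) = 0 :=
  congrArg ULift.down (map_zero (NatTrans.app (F := dual F.obj)
    (G := preadditiveCoyoneda.obj W ⋙ AddCommGrpCat.uliftFunctor.{u, v}) α Z).hom)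

/-- If `g` is a weak cokernel of `f` and the sequence
`C(-, X) ⟶ C(-, Y) ⟶ C(-, Y₁) ⟶ C(-, Y₂)` is exact, then the module presented by `f` is
reflexive. -/
lemma Presents.isReflexive {Y₂ : C} {g₂ : Y₁ ⟶ Y₂} (h : Presents f F.obj)
    (hg : IsWeakCokernel f g) (hf : IsWeakKernel f g) (hg₂ : IsWeakKernel g g₂) :
    IsReflexive F := by
  obtain ⟨π, h1, h2⟩ := h
  obtain ⟨φ, hφ, huniv⟩ := exists_weakly_universal h1 h2 hg
  have hφ' : ∀ (W : Cᵒᵖ) (y : W.unop ⟶ Y), φ.app W (π.app W y) = y ≫ g :=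
    fun W y => ConcreteCategory.congr_hom (NatTrans.congr_app hφ W) y
  refine isReflexive_iff.2 fun W => ⟨?_, fun α => ?_⟩
  · refine (injective_iff_map_eq_zero ((toDoubleDual F.obj).app W).hom).2 fun ⟨x⟩ hx => ?_
    obtain ⟨y, rfl⟩ := h2 W x
    change W.unop ⟶ Y at y
    have hy : y ≫ g = 0 := (hφ' W y).symm.trans (congrArg (fun α => evalDual F α φ) hx)
    obtain ⟨t, rfl⟩ := hf.2 y hy
    exact congrArg ULift.up ((h1 W).apply_apply_eq_zero t)
  -- The value of `α` at `φ` is killed by `g₂`, so it lifts along `g` to some `y`; the class of `y`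
  -- in `F` is the required preimage.
  · have hw : evalDual F α φ ≫ g₂ = 0 := by
      rw [← evalDual_comp]
      have : φ ≫ preadditiveYoneda.map g₂ = 0 := by
        have := h2.epi
        rw [← cancel_epi π, ← Category.assoc, hφ, comp_zero, ← Functor.map_comp, hg₂.1]
        ext
        exact comp_zero
      rw [this, evalDual_zero]
    obtain ⟨y, hy⟩ := hg₂.2 _ hw
    refine ⟨ULift.up (π.app W y), evalDual_ext fun Z ψ => ?_⟩
    obtain ⟨t, rfl⟩ := huniv ψ
    rw [evalDual_comp, evalDual_comp, ← hy]
    exact congrArg (· ≫ t) (hφ' W y)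

/-- If `f` has a cokernel, then a reflexive module presented by `f` is representable. -/
lemma Presents.exists_iso_yoneda_of_isReflexive (h : Presents f F.obj) (hg : IsWeakCokernel f g)
    [Epi g] (hF : IsReflexive F) : Nonempty (preadditiveYoneda.obj Y₁ ≅ F.obj) := by
  obtain ⟨π, h1, h2⟩ := h
  obtain ⟨φ, hφ, huniv⟩ := exists_weakly_universal h1 h2 hg
  have hφe : ∀ {Z : C} {s t : Y₁ ⟶ Z},
      φ ≫ preadditiveYoneda.map s = φ ≫ preadditiveYoneda.map t → s = t := by
    intro Z s t hst
    rw [← cancel_epi g]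
    apply preadditiveYoneda.map_injective
    rw [Functor.map_comp, Functor.map_comp, ← hφ, Category.assoc, Category.assoc, hst]
  rw [isReflexive_iff] at hF
  suffices IsIso φ from ⟨(asIso φ).symm⟩
  refine (isIso_iff_app_bijective _).2 fun W => ⟨?_, fun w => ?_⟩
  · refine (injective_iff_map_eq_zero (φ.app W).hom).2 fun x hx => ?_
    have h0 : (toDoubleDual F.obj).app W (ULift.up x) = 0 := by
      refine evalDual_ext fun Z ψ => ?_
      obtain ⟨t, rfl⟩ := huniv ψ
      rw [evalDual_comp, evalDual_toDoubleDual]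
      refine (congrArg (fun k : W.unop ⟶ Y₁ => k ≫ t) hx).trans ?_
      exact zero_comp
    exact congrArg ULift.down ((hF W).1 (h0.trans (map_zero _).symm))
  · change W.unop ⟶ Y₁ at w
    -- As `g` is epi, the factorization `t ψ` is unique, hence additive and natural in `ψ`. Thus ψ ↦
    -- w ≫ t ψ lies in the double dual, and its value at `φ` is `w` since t φ = 1.
    choose t ht using @huniv
    have hadd : ∀ {Z : C} (ψ ψ' : F.obj ⟶ preadditiveYoneda.obj Z),
        t (ψ + ψ') = t ψ + t ψ' := fun ψ ψ' => hφe (by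
      have : preadditiveYoneda.map (t ψ + t ψ')
          = preadditiveYoneda.map (t ψ) + preadditiveYoneda.map (t ψ') := by
        ext
        exact Preadditive.comp_add _ _ _ _ _ _
      rw [ht, this, Preadditive.comp_add, ht, ht])
    have hcomp : ∀ {Z Z' : C} (ψ : F.obj ⟶ preadditiveYoneda.obj Z) (a : Z ⟶ Z'),
        t (ψ ≫ preadditiveYoneda.map a) = t ψ ≫ a := fun ψ a => hφe (by
      rw [ht, Functor.map_comp, ← Category.assoc, ht])
    let α : dual F.obj ⟶ preadditiveCoyoneda.obj W ⋙ AddCommGrpCat.uliftFunctor.{u, v} :=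
      { app := fun Z => AddCommGrpCat.ofHom
          (AddMonoidHom.mk' (fun ψ : F.obj ⟶ preadditiveYoneda.obj Z => ULift.up (w ≫ t ψ))
            (fun ψ ψ' => congrArg ULift.up
              ((congrArg (w ≫ ·) (hadd ψ ψ')).trans (Preadditive.comp_add _ _ _ _ _ _))))
        naturality := fun Z Z' a => by
          ext ψ
          exact congrArg ULift.up
            ((congrArg (w ≫ ·) (hcomp ψ a)).trans (Category.assoc _ _ _).symm) }
    obtain ⟨⟨x⟩, hx⟩ := (hF W).2 α
    refine ⟨x, ?_⟩
    have h3 : φ.app W x = w ≫ t φ := congrArg (fun β => evalDual F β φ) hx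
    have h4 : t φ = 𝟙 Y₁ := hφe (by rw [ht, CategoryTheory.Functor.map_id, Category.comp_id])
    rw [h3, h4, Category.comp_id]

end Reflexive

/-! ### Non-split monomorphisms from non-regularity -/

section Regular

/-- If all monomorphisms split and `g` has a weak kernel that is a split epimorphism followed by
a split monomorphism, then so is `g`. -/
lemma IsWeakKernel.exists_split_factorization [IsIdempotentComplete C]
    (hsplit : ∀ {X Y : C} (f : X ⟶ Y), Mono f → IsSplitMono f) {A B D : C} {f : A ⟶ B} {g : B ⟶ D}
    (h : IsWeakKernel f g)
    (hf : ∃ (Z : C) (p : A ⟶ Z) (j : Z ⟶ B), IsSplitEpi p ∧ IsSplitMono j ∧ p ≫ j = f) :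
    ∃ (Z : C) (p : B ⟶ Z) (j : Z ⟶ D), IsSplitEpi p ∧ IsSplitMono j ∧ p ≫ j = g := by
  obtain ⟨Z, p, j, hp, hj, rfl⟩ := hf
  have hjg : j ≫ g = 0 := by
    rw [← cancel_epi p, ← Category.assoc, h.1, comp_zero]
  have hjr : j ≫ retraction j = 𝟙 Z := IsSplitMono.id j
  -- `W` is a complement of `Z` in `B`. Maps killed by `g` factor through `j`, so `g` restricted to
  -- `W` is mono, hence split.
  obtain ⟨W, k, q, hkq, hqk⟩ := IsIdempotentComplete.idempotents_split B (𝟙 B - retraction j ≫ j)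
    (by simp [Preadditive.sub_comp, Preadditive.comp_sub, reassoc_of% hjr])
  have hk : IsSplitMono k := ⟨⟨⟨q, hkq⟩⟩⟩
  have hjq : j ≫ q = 0 := by
    rw [← cancel_mono k, Category.assoc, hqk, zero_comp, Preadditive.comp_sub, Category.comp_id,
      reassoc_of% hjr, sub_self]
  have hmono : Mono (k ≫ g) := by
    refine Preadditive.mono_of_cancel_zero _ fun {T} x hx => ?_
    obtain ⟨m, hm⟩ := h.2 (x ≫ k) (by rw [Category.assoc, hx])
    rw [← Category.comp_id x, ← hkq, ← Category.assoc, ← hm, Category.assoc, Category.assoc, hjq,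
      comp_zero, comp_zero]
  refine ⟨W, q, k ≫ g, ⟨⟨⟨k, hkq⟩⟩⟩, hsplit _ hmono, ?_⟩
  rw [← Category.assoc, hqk, Preadditive.sub_comp, Category.assoc, hjg, comp_zero, sub_zero,
    Category.id_comp]

/-- A property of morphisms transfers along equality of arrows. -/
lemma of_arrow_eq {D : Type*} [Category* D] {P : ∀ {X Y : D}, (X ⟶ Y) → Prop} {A B X Y : D} {g : A ⟶ B} {f : X ⟶ Y}
    (h : Arrow.mk g = Arrow.mk f) (hg : P g) : P f := by
  have hg' : P (Arrow.mk g).hom := hg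
  rw [h] at hg'
  exact hg'

/-- An idempotent complete category with `n`-kernels that is not von Neumann regular has a
monomorphism that does not split. -/
lemma exists_mono_not_isSplitMono [IsIdempotentComplete C] {n : ℕ}
    (hker : ∀ {X Y : C} (f : X ⟶ Y), ∃ S : ComposableArrows C (n + 1), IsNKernel S f)
    (hreg : ¬ IsVonNeumannRegular C) : ∃ (X Y : C) (f : X ⟶ Y), Mono f ∧ ¬ IsSplitMono f := by
  by_contra! hcon
  refine hreg fun {X Y} f => ?_
  have hsplit : ∀ {X Y : C} (f : X ⟶ Y), Mono f → IsSplitMono f := fun {X Y} f => hcon X Y f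
  obtain ⟨S, hS⟩ := hker f
  have key : ∀ (i : ℕ) (hi : i ≤ n), ∃ (Z : C) (p : S.obj' i ⟶ Z) (j : Z ⟶ S.obj' (i + 1)),
      IsSplitEpi p ∧ IsSplitMono j ∧ p ≫ j = arr S i hi := by
    intro i
    induction i with
    | zero =>
      intro _
      have : Mono (arr S 0 (Nat.zero_le n)) := ⟨fun {W} a b hab => hS.mono (op W) hab⟩
      exact ⟨_, 𝟙 _, arr S 0 (Nat.zero_le n), inferInstance, hsplit _ this, Category.id_comp _⟩
    | succ i ih =>
      intro hi
      exact (isWeakKernel_iff.1 (hS.exact i hi)).exists_split_factorization hsplit (ih (by omega))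
  exact of_arrow_eq (P := fun {X Y} f => ∃ (Z : C) (p : X ⟶ Z) (j : Z ⟶ Y),
    IsSplitEpi p ∧ IsSplitMono j ∧ p ≫ j = f) hS.last_eq (key n le_rfl)

/-- The module presented by a non-split monomorphism has projective dimension one. -/
lemma projDim_eq_one_of_not_isSplitMono [HasFiniteBiproducts C] {F : FPMod C} {X Y : C} {f : X ⟶ Y}
    (h : Presents f F.obj) [Mono f] (hf : ¬ IsSplitMono f) : projDim F = 1 := by
  refine projDim_eq_one h.hasProjectiveResolutionOfLength_one fun h0 => hf ?_
  have := h0.projective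
  obtain ⟨r, hr⟩ := h.exists_quasiInverse
  exact ⟨⟨⟨r, by rw [← cancel_mono f, Category.assoc, hr, Category.id_comp]⟩⟩⟩

end Regular

/-! ### The two cases of n -/

section NAbelianCategory

variable [HasFiniteBiproducts C] [IsIdempotentComplete C] {n : ℕ} {F : FPMod C}

/-- The condition n ≥ 2 is what provides exactness at the third term, C(-, Y₁). -/
lemma IsNAbelian.isReflexive_of_two_le (hC : IsNAbelian C n) (hn : 2 ≤ n) (h : projDim F = 1) :
    IsReflexive F := by
  obtain ⟨X, Y, f, hf, hpres⟩ :=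
    (hasProjectiveResolutionOfLength_one_of_projDim_eq_one h).exists_mono_presents
  obtain ⟨S, hS⟩ := hC.hasNCokernels f
  have hK := hC.mono_isNKernel f hf S hS
  exact Presents.isReflexive
    (of_arrow_eq (P := fun f => Presents f F.obj) hS.first_eq.symm hpres)
    (isWeakCokernel_of_modExact (hS.exact 0 (by omega)))
    (isWeakKernel_iff.1 (hK.exact 0 (by omega))) (isWeakKernel_iff.1 (hK.exact 1 hn))

lemma IsNAbelian.two_le_of_isReflexive (hC : IsNAbelian C n) (hn : 1 ≤ n) (h : 1 ≤ projDim F)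
    (hF : IsReflexive F) : 2 ≤ n := by
  by_contra hn2
  obtain rfl : n = 1 := by omega
  obtain ⟨-, X, Y, f, hpres⟩ := F.property
  obtain ⟨S, hS⟩ := hC.hasNCokernels f
  -- For n = 1 the weak cokernel of `f` is also the last arrow of the sequence, hence epi.
  have : Epi (arr S 1 le_rfl) := ⟨fun {W} a b hab => hS.mono W hab⟩
  obtain ⟨e⟩ := Presents.exists_iso_yoneda_of_isReflexive
    (of_arrow_eq (P := fun f => Presents f F.obj) hS.first_eq.symm hpres)
    (isWeakCokernel_of_modExact (hS.exact 0 le_rfl)) hF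
  exact not_hasProjectiveResolutionOfLength_zero h (hasProjectiveResolutionOfLength_zero_of_iso e)

end NAbelianCategory

end NAbelian

end

theorem corollary5 {C : Type u} [Category.{v} C] [Preadditive C] [HasFiniteBiproducts C]
    [IsIdempotentComplete C] (n : ℕ) (hn : 1 ≤ n) (hC : NAbelian.IsNAbelian C n)
    (hreg : ¬ NAbelian.IsVonNeumannRegular C) :
    List.TFAE
      [2 ≤ n,
        ∀ F : NAbelian.FPMod C, NAbelian.projDim F = 1 → NAbelian.IsReflexive F,
        ∃ F : NAbelian.FPMod C, NAbelian.projDim F = 1 ∧ NAbelian.IsReflexive F,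
        ∃ F : NAbelian.FPMod C, 1 ≤ NAbelian.projDim F ∧ NAbelian.IsReflexive F] := by
  tfae_have 1 → 2 := fun h F hF => hC.isReflexive_of_two_le h hF
  tfae_have 2 → 3 := fun h => by
    obtain ⟨X, Y, f, hf, hsplit⟩ := NAbelian.exists_mono_not_isSplitMono hC.hasNKernels hreg
    have hpres := NAbelian.presents_cokernel f
    have hpd : NAbelian.projDim (⟨_, hpres.isFinitelyPresented⟩ : NAbelian.FPMod C) = 1 :=
      NAbelian.projDim_eq_one_of_not_isSplitMono hpres hsplit
    exact ⟨_, hpd, h _ hpd⟩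
  tfae_have 3 → 4 := fun ⟨F, hF, hr⟩ => ⟨F, hF.ge, hr⟩
  tfae_have 4 → 1 := fun ⟨_, hF, hr⟩ => hC.two_le_of_isReflexive hn hF hr
  tfae_finish
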